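/- An interval exchange transformation (IET) $T$ of $[0,1)$ is a bijection of $[0,1)$ that translates each of finitely many intervals $[b_{i-1},b_i)$, $0=b_0<b_1<\dots<b_n=1$, where $n$ is minimal. Its lengths are $\lambda(T)=(b_i-b_{i-1})_{1\le i\le n}$, its set of discontinuities is $\Delta(T)=\{b_1,\dots,b_{n-1}\}$, its permutation is $\pi(T)=\sigma\in\mathfrak S_n$, where $\sigma(i)$ is the position of the image of the $i$-th interval, and $\omega(T)=(t_1,\dots,t_n)$ are its translation lengths, i.e. $T(x)=x+t_i$ on $[b_{i-1},b_i)$. The set $\mathrm{IET}$ of all IETs of $[0,1)$ carries the distance $d(S,T)=\|\lambda(S)-\lambda(T)\|_1$ if $\pi(S)=\pi(T)$, and $d(S,T)=\infty$ otherwise. For a positive integer $q$, $T$ is $q$-rational if $\Delta(T)\subset\frac1q\mathbb Z$, and it is rational if it is $q'$-rational for some positive integer $q'$. A permutation $\sigma\in\mathfrak S_n$ is driftable if there are two IETs $T,T'$ with permutation $\sigma$ (that is, with $\lambda(T')=\lambda(T)+(d_1,\dots,d_n)$, $\sum_i d_i=0$) such that every translation length of $T'$ is strictly larger than the corresponding translation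 length of $T$. Proposition. Let $q$ be a positive integer, let $T_0$ be a $q$-rational IET whose permutation $\sigma=\pi(T_0)$ is driftable, and let $S$ be any IET. Then there are a set $\mathcal U\subset\mathrm{IET}$ containing $S$ and an open set $\mathcal V$ of IETs with permutation $\sigma$, having $T_0$ as an accumulation point, such that for all $R\in\mathcal U$ and $T\in\mathcal V$ the group $\langle R,T\rangle$ is not free of rank $2$. More precisely, for all such $R$ and $T$ there is an integer $k\ge 1$ such that $$[U,\,T^kUT^{-k}]=\mathrm{id},\qquad U=[T^{q!},\,RT^{q!}R^{-1}],$$ where $[a,b]=aba^{-1}b^{-1}$, and the corresponding word is a non-trivial element of the free group on two letters. Moreover, if $S$ is rational, or if distinct points of $\Delta(S)$ are never congruent modulo $\frac1q\mathbb Z$, then $\mathcal U$ is a neighbourhood of $S$. -/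

import Mathlib

open Topology
open scoped commutatorElement

noncomputable section

/-- The left endpoint of the `i`-th interval when intervals of lengths `l` are laid side by side
from `0`, the `j`-th one being put at position `σ j`. -/
def leftEnd {n : ℕ} (σ : Equiv.Perm (Fin n)) (l : Fin n → ℝ) (i : Fin n) : ℝ :=
  ∑ j with σ j < σ i, l j

/-- The translation lengths `(t_1, …, t_n)` attached to a permutation and to lengths:
the left endpoint of the image of the `i`-th interval minus its own left endpoint. -/
def translationLength {n : ℕ} (σ : Equiv.Perm (Fin n)) (l : Fin n → ℝ) (i : Fin n) : ℝ :=
  leftEnd σ l i - leftEnd 1 l i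

/-- A permutation `σ` is driftable if, for lengths `l` of an IET with permutation `σ`, there is `d`
with `∑ d_i = 0` such that the IET with permutation `σ` and lengths `l + d` has all its
translation lengths larger than those of the first one. (Since translation lengths are linear
in the lengths, this does not depend on `l`.) -/
def Driftable {n : ℕ} (σ : Equiv.Perm (Fin n)) : Prop :=
  ∃ l d : Fin n → ℝ, (∀ i, 0 < l i) ∧ ∑ i, l i = 1 ∧ ∑ i, d i = 0 ∧ (∀ i, 0 < l i + d i) ∧
    ∀ i, translationLength σ l i < translationLength σ (fun j => l j + d j) i

/-- An interval exchange transformation of `[0,1)`, given by the number `n` of its intervals of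
continuity, its underlying permutation (`perm i` is the position of the image of the `i`-th
interval) and the lengths of its intervals. The field `reduced` says that two consecutive
intervals do not stay consecutive, so the `n` intervals are exactly the intervals of continuity.
The transformation itself is `IET.toPerm`. -/
structure IET where
  n : ℕ
  perm : Equiv.Perm (Fin n)
  len : Fin n → ℝ
  len_pos : ∀ i, 0 < len i
  len_sum : ∑ i, len i = 1
  reduced : ∀ i j : Fin n, (j : ℕ) = i + 1 → (perm j : ℕ) ≠ perm i + 1

section Tiling

variable {n : ℕ} (σ : Equiv.Perm (Fin n)) (l : Fin n → ℝ)

theorem leftEnd_add_le_of_lt (hl : ∀ i, 0 < l i) {i j : Fin n} (h : σ i < σ j) :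
    leftEnd σ l i + l i ≤ leftEnd σ l j := by
  unfold leftEnd
  rw [add_comm, ← Finset.sum_insert (by simp)]
  apply Finset.sum_le_sum_of_subset_of_nonneg
  · intro k hk
    simp only [Finset.mem_insert, Finset.mem_filter, Finset.mem_univ, true_and] at hk ⊢
    rcases hk with rfl | hk
    · exact h
    · exact hk.trans h
  · intro k _ _
    exact (hl k).le

theorem leftEnd_nonneg (hl : ∀ i, 0 < l i) (i : Fin n) : 0 ≤ leftEnd σ l i :=
  Finset.sum_nonneg fun k _ => (hl k).le

theorem leftEnd_add_le_one (hl : ∀ i, 0 < l i) (hs : ∑ i, l i = 1) (i : Fin n) :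
    leftEnd σ l i + l i ≤ 1 := by
  unfold leftEnd
  rw [add_comm, ← Finset.sum_insert (by simp), ← hs]
  exact Finset.sum_le_sum_of_subset_of_nonneg (Finset.subset_univ _) fun k _ _ => (hl k).le

/-- The map from the disjoint union of the intervals `[0, l_i)` to `[0,1)` that puts the `i`-th
interval at position `σ i`. -/
def tileFun (hl : ∀ i, 0 < l i) (hs : ∑ i, l i = 1) :
    (Σ i : Fin n, Set.Ico (0 : ℝ) (l i)) → Set.Ico (0 : ℝ) 1 :=
  fun p => ⟨leftEnd σ l p.1 + p.2.1,
    add_nonneg (leftEnd_nonneg σ l hl p.1) p.2.2.1,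
    lt_of_lt_of_le (add_lt_add_of_le_of_lt le_rfl p.2.2.2) (leftEnd_add_le_one σ l hl hs p.1)⟩

theorem tileFun_bijective (hl : ∀ i, 0 < l i) (hs : ∑ i, l i = 1) :
    Function.Bijective (tileFun σ l hl hs) := by
  constructor
  · rintro ⟨i, s, hs0, hs1⟩ ⟨j, t, ht0, ht1⟩ h
    have h' : leftEnd σ l i + s = leftEnd σ l j + t := congrArg Subtype.val h
    rcases lt_trichotomy (σ i) (σ j) with hij | hij | hij
    · have := leftEnd_add_le_of_lt σ l hl hij
      linarith
    · obtain rfl := σ.injective hij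
      obtain rfl : s = t := by linarith
      rfl
    · have := leftEnd_add_le_of_lt σ l hl hij
      linarith
  · rintro ⟨x, hx0, hx1⟩
    have hn : 0 < n := by
      rcases Nat.eq_zero_or_pos n with rfl | h
      · simp at hs
      · exact h
    have hne : (Finset.univ.filter fun i => leftEnd σ l i ≤ x).Nonempty := by
      refine ⟨σ.symm ⟨0, hn⟩, ?_⟩
      have : leftEnd σ l (σ.symm ⟨0, hn⟩) = 0 := by
        unfold leftEnd
        apply Finset.sum_eq_zero
        intro j hj
        simp [Fin.lt_def] at hj
      simp [this, hx0]
    obtain ⟨i, hi, hmax⟩ := Finset.exists_max_image _ (fun i => σ i) hne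
    simp only [Finset.mem_filter, Finset.mem_univ, true_and] at hi hmax
    have hlt : x < leftEnd σ l i + l i := by
      by_contra! hcon
      by_cases hlast : (σ i : ℕ) + 1 < n
      · have hk := hmax (σ.symm ⟨(σ i : ℕ) + 1, hlast⟩) (by
          refine le_trans (le_of_eq ?_) hcon
          unfold leftEnd
          rw [add_comm (Finset.sum _ _), ← Finset.sum_insert (by simp)]
          congr 1
          ext j
          simp only [Finset.mem_filter, Finset.mem_univ, true_and, Finset.mem_insert,
            Equiv.apply_symm_apply, Fin.lt_def, ← σ.injective.eq_iff (a := j), Fin.ext_iff]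
          omega)
        simp [Fin.le_def] at hk
      · have : leftEnd σ l i + l i = 1 := by
          unfold leftEnd
          rw [add_comm, ← Finset.sum_insert (by simp), ← hs]
          congr 1
          ext j
          simp only [Finset.mem_filter, Finset.mem_univ, true_and, Finset.mem_insert,
            Fin.lt_def, ← σ.injective.eq_iff (a := j), Fin.ext_iff, iff_true]
          have := (σ j).isLt
          omega
        linarith
    refine ⟨⟨i, x - leftEnd σ l i, by linarith, by linarith⟩, ?_⟩
    apply Subtype.ext
    simp [tileFun]

/-- The tiling of `[0,1)` by intervals of lengths `l` in the order given by `σ`. -/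
def tile (hl : ∀ i, 0 < l i) (hs : ∑ i, l i = 1) :
    (Σ i : Fin n, Set.Ico (0 : ℝ) (l i)) ≃ Set.Ico (0 : ℝ) 1 :=
  Equiv.ofBijective (tileFun σ l hl hs) (tileFun_bijective σ l hl hs)

end Tiling

namespace IET

/-- The transformation of `[0,1)`: the `i`-th interval of the tiling in the natural order is
translated onto the `i`-th interval of the tiling in the order given by the permutation. -/
def toPerm (T : IET) : Equiv.Perm (Set.Ico (0 : ℝ) 1) :=
  (tile 1 T.len T.len_pos T.len_sum).symm.trans (tile T.perm T.len T.len_pos T.len_sum)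

/-- On the `i`-th interval, an IET is the translation by its `i`-th translation length. -/
theorem toPerm_apply (T : IET) (i : Fin T.n) (x : Set.Ico (0 : ℝ) 1)
    (h₀ : leftEnd 1 T.len i ≤ x) (h₁ : (x : ℝ) < leftEnd 1 T.len i + T.len i) :
    (T.toPerm x : ℝ) = x + translationLength T.perm T.len i := by
  have hx : (tile 1 T.len T.len_pos T.len_sum).symm x =
      ⟨i, x - leftEnd 1 T.len i, by linarith, by linarith⟩ := by
    rw [Equiv.symm_apply_eq]
    apply Subtype.ext
    simp [tile, tileFun]
  simp only [toPerm, Equiv.trans_apply, hx]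
  simp only [tile, tileFun, Equiv.ofBijective_apply, translationLength]
  ring

/-- The underlying permutation `π(T)`, an element of the disjoint union of the symmetric groups. -/
def type (T : IET) : Σ n : ℕ, Equiv.Perm (Fin n) := ⟨T.n, T.perm⟩

/-- The set `Δ(T)` of discontinuity points of `T`: the left endpoints `b_1 < … < b_{n-1}` of all
its intervals but the first one. -/
def disc (T : IET) : Set ℝ :=
  {x | ∃ i : Fin T.n, 0 < (i : ℕ) ∧ x = leftEnd 1 T.len i}

/-- All discontinuities are rational with denominator `q`. -/
def IsQRational (q : ℕ) (T : IET) : Prop :=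
  ∀ x ∈ T.disc, ∃ p : ℤ, x = p / q

/-- `T` is rational if it is `q`-rational for some positive integer `q`. -/
def IsRational (T : IET) : Prop :=
  ∃ q : ℕ, 0 < q ∧ T.IsQRational q

open Classical in
/-- The distance between IETs: the `ℓ¹` distance of the lengths if the permutations coincide,
and `∞` otherwise. -/
instance : EDist IET where
  edist S T :=
    if h : S.type = T.type then
      ENNReal.ofReal (∑ i, |S.len i - T.len (Fin.cast (congrArg Sigma.fst h) i)|)
    else ⊤

/-- The distance between two IETs with the same permutation. -/
theorem edist_mk {n : ℕ} {σ : Equiv.Perm (Fin n)} {l l' : Fin n → ℝ} (h₁ h₂ h₃ h₁' h₂' h₃') :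
    edist (IET.mk n σ l h₁ h₂ h₃) (IET.mk n σ l' h₁' h₂' h₃') =
      ENNReal.ofReal (∑ i, |l i - l' i|) := by
  simp [edist, type]

theorem edist_of_type_ne {S T : IET} (h : S.type ≠ T.type) : edist S T = ⊤ := by
  simp [edist, h]

instance : EMetricSpace IET where
  edist_self := by
    rintro ⟨n, σ, l, _, _, _⟩
    simp [edist_mk]
  edist_comm := by
    intro S T
    by_cases h : S.type = T.type
    · obtain ⟨n, σ, l, _, _, _⟩ := S
      obtain ⟨n', σ', l', _, _, _⟩ := T
      cases h
      simp [edist_mk, abs_sub_comm]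
    · rw [edist_of_type_ne h, edist_of_type_ne (Ne.symm h)]
  edist_triangle := by
    intro S T R
    by_cases h : S.type = T.type
    · by_cases h' : T.type = R.type
      · obtain ⟨n, σ, l, _, _, _⟩ := S
        obtain ⟨n', σ', l', _, _, _⟩ := T
        obtain ⟨n'', σ'', l'', _, _, _⟩ := R
        cases h
        cases h'
        rw [edist_mk, edist_mk, edist_mk, ← ENNReal.ofReal_add (by positivity) (by positivity),
          ← Finset.sum_add_distrib]
        exact ENNReal.ofReal_le_ofReal (Finset.sum_le_sum fun i _ => abs_sub_le _ _ _)
      · simp [edist_of_type_ne h']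
    · simp [edist_of_type_ne h]
  eq_of_edist_eq_zero := by
    intro S T h0
    by_cases h : S.type = T.type
    · obtain ⟨n, σ, l, _, _, _⟩ := S
      obtain ⟨n', σ', l', _, _, _⟩ := T
      cases h
      rw [edist_mk, ENNReal.ofReal_eq_zero] at h0
      have h1 := (Finset.sum_eq_zero_iff_of_nonneg (fun i _ => abs_nonneg (l i - l' i))).1
        (le_antisymm h0 (Finset.sum_nonneg fun i _ => abs_nonneg _))
      obtain rfl : l = l' := by
        funext i
        simpa [sub_eq_zero] using h1 i (Finset.mem_univ i)
      rfl
    · simp [edist_of_type_ne h] at h0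

end IET

/-- The word `[u, t^k u t^{-k}]` with `u = [t^{q!}, r t^{q!} r⁻¹]`, evaluated in a group. -/
def driftWord {G : Type*} [Group G] (q k : ℕ) (r t : G) : G :=
  ⁅⁅t ^ q.factorial, r * t ^ q.factorial * r⁻¹⁆,
    t ^ k * ⁅t ^ q.factorial, r * t ^ q.factorial * r⁻¹⁆ * (t ^ k)⁻¹⁆

end

/-!
A `q`-rational IET translates every interval by a multiple of `1 / q`, so it is the identity modulo
`1 / q`. An IET `T` with the same permutation and slightly larger translation lengths therefore
drifts: modulo `1 / q` it moves every point a little to the right, by amounts that are comparable to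
each other.

Since `T₀` permutes the `q` intervals `[i / q, (i + 1) / q)`, its power `T₀ ^ q!` is the identity,
and `T ^ q!` is a small translation in the middle of each of them. Translations commute, so
`u = ⁅T ^ q!, R * T ^ q! * R⁻¹⁆` moves only points that are close, modulo `1 / q`, to a finite set
depending on `R`. For a suitable `k`, the drift of `T ^ k` pushes the neighbourhood of this finite
set off itself. Then `u` and `T ^ k * u * (T ^ k)⁻¹` have disjoint supports and commute.

The resulting word is non-trivial in `SL(2, ℤ / p)` for a large prime `p`, and every generating pair
of a free group of rank two can be sent to any prescribed pair of elements of a finite group.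
-/

section Word

theorem map_driftWord {G H : Type*} [Group G] [Group H] (f : G →* H) (q k : ℕ) (r t : G) :
    f (driftWord q k r t) = driftWord q k (f r) (f t) := by
  simp only [driftWord, map_commutatorElement, map_mul, map_inv, map_pow]

open ModularGroup in
theorem modularGroup_mul_apply_sub_mul_apply {N : ℕ} {u : Matrix.SpecialLinearGroup (Fin 2) ℤ}
    (hu : u = ⁅T ^ N, S * T ^ N * S⁻¹⁆) (k : ℕ) :
    (u * (T ^ k * u * (T ^ k)⁻¹)) 1 0 - (T ^ k * u * (T ^ k)⁻¹ * u) 1 0 = 2 * k * (N : ℤ) ^ 6 := by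
  have coe_T_pow (m : ℕ) : (T ^ m).1 = !![1, (m : ℤ); 0, 1] := by
    simpa only [zpow_natCast] using coe_T_zpow m
  simp only [hu, commutatorElement_def, Matrix.SpecialLinearGroup.coe_mul,
    Matrix.SpecialLinearGroup.coe_inv, coe_T_pow, coe_S, Matrix.adjugate_fin_two_of,
    Matrix.mul_fin_two, mul_inv_rev, inv_inv, Matrix.of_apply, Matrix.cons_val_zero,
    Matrix.cons_val_one]
  ring

theorem exists_finite_driftWord_ne_one (q : ℕ) {k : ℕ} (hk : 0 < k) :
    ∃ (G : Type) (_ : Group G) (_ : Finite G) (r t : G), driftWord q k r t ≠ 1 := by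
  have hn : 2 * k * q.factorial ^ 6 ≠ 0 := by positivity
  obtain ⟨p, hp_large, hp⟩ := Nat.exists_infinite_primes (2 * k * q.factorial ^ 6 + 1)
  have : Fact p.Prime := ⟨hp⟩
  let f := Matrix.SpecialLinearGroup.map (n := Fin 2) (Int.castRingHom (ZMod p))
  refine ⟨_, inferInstance, inferInstance, f ModularGroup.S, f ModularGroup.T, fun h => ?_⟩
  rw [← map_driftWord, driftWord, map_commutatorElement, commutatorElement_eq_one_iff_mul_comm,
    ← map_mul, ← map_mul] at h
  have hentry := congrArg (fun g : Matrix.SpecialLinearGroup (Fin 2) (ZMod p) => g 1 0) h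
  simp only [f, Matrix.SpecialLinearGroup.map_apply_coe, RingHom.mapMatrix_apply,
    Matrix.map_apply] at hentry
  rw [← sub_eq_zero, ← map_sub, modularGroup_mul_apply_sub_mul_apply rfl, eq_intCast] at hentry
  have hdvd : p ∣ 2 * k * q.factorial ^ 6 := by
    rw [← ZMod.natCast_eq_zero_iff]
    exact_mod_cast hentry
  have := Nat.le_of_dvd (Nat.pos_of_ne_zero hn) hdvd
  omega

theorem driftWord_freeGroup_ne_one (q : ℕ) {k : ℕ} (hk : 0 < k) :
    driftWord q k (FreeGroup.of (0 : Fin 2)) (FreeGroup.of (1 : Fin 2)) ≠ 1 := by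
  obtain ⟨G, _, _, r, t, h⟩ := exists_finite_driftWord_ne_one q hk
  refine fun h1 => h ?_
  simpa [map_driftWord] using congrArg (FreeGroup.lift ![r, t]) h1

/-- `v` need not correspond to a basis: both `H →* G` and `ι → G` have `|G| ^ |ι|` elements, so the
injection `f ↦ f ∘ v` is onto. -/
theorem exists_monoidHom_apply_eq_of_mulEquiv_freeGroup {ι G H : Type*} [Finite ι] [Group G]
    [Finite G] [Group H] (e : H ≃* FreeGroup ι) {v : ι → H}
    (hv : Subgroup.closure (Set.range v) = ⊤) (w : ι → G) :
    ∃ f : H →* G, ∀ i, f (v i) = w i := by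
  let E : (ι → G) ≃ (H →* G) := FreeGroup.lift.trans e.symm.monoidHomCongrLeftEquiv
  have restrict_injective : Function.Injective fun (f : H →* G) i => f (v i) := by
    refine fun f g hfg => MonoidHom.eq_of_eqOn_dense hv ?_
    rintro _ ⟨i, rfl⟩
    exact congrFun hfg i
  obtain ⟨w', hw'⟩ := Finite.surjective_of_injective (restrict_injective.comp E.injective) w
  exact ⟨E w', congrFun hw'⟩

theorem isEmpty_closure_pair_mulEquiv_freeGroup {H : Type*} [Group H] {q k : ℕ} (hk : 0 < k)
    {r t : H} (hw : driftWord q k r t = 1) :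
    IsEmpty (Subgroup.closure {r, t} ≃* FreeGroup (Fin 2)) := by
  refine ⟨fun e => ?_⟩
  obtain ⟨G, _, _, a, b, hab⟩ := exists_finite_driftWord_ne_one q hk
  let r' : Subgroup.closure {r, t} := ⟨r, Subgroup.subset_closure (by simp)⟩
  let t' : Subgroup.closure {r, t} := ⟨t, Subgroup.subset_closure (by simp)⟩
  have hw' : driftWord q k r' t' = 1 := by
    apply (Subgroup.closure {r, t}).subtype_injective
    rwa [map_driftWord, map_one]
  have hgen : Subgroup.closure (Set.range ![r', t']) = ⊤ := by
    rw [← Subgroup.closure_closure_coe_preimage (k := {r, t}), Matrix.range_cons,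
      Matrix.range_cons, Matrix.range_empty]
    congr 1
    ext x
    simp [r', t', Subtype.ext_iff, or_comm]
  obtain ⟨f, hf⟩ := exists_monoidHom_apply_eq_of_mulEquiv_freeGroup e hgen ![a, b]
  refine hab ?_
  rw [← show f r' = a from hf 0, ← show f t' = b from hf 1, ← map_driftWord, hw', map_one]

end Word

section Perm

variable {α : Type*}

theorem commutatorElement_conj_eq_one_of_displaces_support {u g : Equiv.Perm α}
    (h : ∀ x, u x ≠ x → u (g x) = g x) : ⁅u, g * u * g⁻¹⁆ = 1 := by
  rw [commutatorElement_eq_one_iff_commute]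
  refine Equiv.Perm.Disjoint.commute fun x => ?_
  obtain ⟨y, rfl⟩ := g.surjective x
  rw [or_iff_not_imp_right]
  intro hy
  refine h y fun hfix => hy ?_
  simp [hfix]

theorem perm_pow_factorial_ncard_apply_eq_self (f : Equiv.Perm α) {s : Set α} (hs : s.Finite)
    (hf : Set.MapsTo f s s) {x : α} (hx : x ∈ s) : (f ^ s.ncard.factorial) x = x := by
  have : Finite s := hs
  have hf' : ∀ y, f y ∈ s ↔ y ∈ s := fun y =>
    ⟨fun h => by simpa using Equiv.Perm.perm_symm_mapsTo_of_mapsTo f hf h, fun h => hf h⟩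
  have h : f.subtypePerm hf' ^ s.ncard.factorial = 1 := by
    rw [← Nat.card_coe_set_eq, ← Nat.card_perm]
    exact pow_card_eq_one'
  rw [Equiv.Perm.subtypePerm_pow] at h
  exact congrArg Subtype.val (Equiv.congr_fun h ⟨x, hx⟩)

end Perm

section Translations

variable {M : Type*} [AddCommGroup M] {X : Set M} {A B R : Equiv.Perm X} {s t : Set M} {a b τ x : M}

/-- The permutation `A` of `X` is the translation by `a` on `s`. For convenience this includes the
inclusion `s ⊆ X`. -/
def TranslatesOn (A : Equiv.Perm X) (s : Set M) (a : M) : Prop :=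
  ∀ y ∈ s, ∃ hy : y ∈ X, (A ⟨y, hy⟩ : M) = y + a

namespace TranslatesOn

theorem mono (h : TranslatesOn A t a) (hst : s ⊆ t) : TranslatesOn A s a :=
  fun y hy => h y (hst hy)

theorem apply_eq (h : TranslatesOn A s a) {y : X} (hy : (y : M) ∈ s) : (A y : M) = y + a :=
  (h y hy).2

theorem mul (hB : TranslatesOn B t b) (hA : TranslatesOn A s a) (hst : Set.MapsTo (· + a) s t) :
    TranslatesOn (B * A) s (a + b) := by
  intro y hy
  obtain ⟨hyX, hAy⟩ := hA y hy
  refine ⟨hyX, ?_⟩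
  rw [Equiv.Perm.mul_apply, hB.apply_eq (by rw [hAy]; exact hst hy), hAy, add_assoc]

theorem inv (h : TranslatesOn A s a) : TranslatesOn A⁻¹ ((· - a) ⁻¹' s) (-a) := by
  intro y hy
  obtain ⟨hX, hA⟩ := h (y - a) hy
  rw [sub_add_cancel] at hA
  have hyX : y ∈ X := hA ▸ (A ⟨y - a, hX⟩).2
  refine ⟨hyX, ?_⟩
  rw [Equiv.Perm.inv_eq_iff_eq.2 (Subtype.ext hA.symm : (⟨y, hyX⟩ : X) = A ⟨y - a, hX⟩),
    ← sub_eq_add_neg]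

theorem conj (hR : TranslatesOn R t τ) (hA : TranslatesOn A s a) (hst : s ⊆ t)
    (hmaps : Set.MapsTo (· + a) s t) :
    TranslatesOn (R * A * R⁻¹) ((· - τ) ⁻¹' s) a := by
  have hinv : TranslatesOn R⁻¹ ((· - τ) ⁻¹' s) (-τ) := (hR.mono hst).inv
  have h := (hR.mul hA hmaps).mul hinv fun y hy => by
    change y + -τ ∈ s
    rwa [← sub_eq_add_neg]
  rwa [show -τ + (a + τ) = a by abel] at h

theorem commutatorElement (hA : TranslatesOn A s a) (hB : TranslatesOn B s b) (hxa : x - a ∈ s)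
    (hxb : x - b ∈ s) (hxab : x - a - b ∈ s) : TranslatesOn ⁅A, B⁆ {x} 0 := by
  have hA' := hA.mono (Set.singleton_subset_iff.2 hxa)
  have hAinv := (hA.mono (Set.singleton_subset_iff.2 hxab)).inv
  have hBinv := (hB.mono (Set.singleton_subset_iff.2 hxb)).inv
  have hB' := hB.mono (Set.singleton_subset_iff.2 hxab)
  have hconj : TranslatesOn (A * B * A⁻¹ * B⁻¹) _ (-b + (-a + (b + a))) :=
    ((hA'.mul hB' ?_).mul hAinv ?_).mul hBinv ?_
  · rw [commutatorElement_def]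
    rw [show -b + (-a + (b + a)) = 0 by abel] at hconj
    exact hconj.mono (by simp)
  all_goals
    rintro y hy
    simp only [Set.mem_preimage, Set.mem_singleton_iff, sub_eq_iff_eq_add] at hy ⊢
    subst hy
    abel

end TranslatesOn

end Translations

section Shadowing

variable {X : Set ℝ} {A B : Equiv.Perm X} {P : Set X} {L η : ℝ}

/-- While `B` permutes the left endpoints `P`, the image under `A` of a shrunken interval slips to
the right by at most `η` at each step, hence the shrinking by `m * η` at the right end. -/
theorem translatesOn_pow_of_shadowing (hB : Set.MapsTo B P P)
    (h : ∀ p ∈ P, ∃ r ∈ Set.Icc 0 η,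
      TranslatesOn A (Set.Icc (p + η) (p + L - η)) (B p - p + r)) (m : ℕ) :
    ∀ p ∈ P, ∃ r ∈ Set.Icc 0 (m * η),
      TranslatesOn (A ^ m) (Set.Icc (p + η) (p + L - (m + 1) * η)) ((B ^ m) p - p + r) := by
  induction m with
  | zero =>
    intro p hp
    obtain ⟨r, -, hA⟩ := h p hp
    refine ⟨0, by simp, fun y hy => ⟨(hA y (by simpa using hy)).1, by simp⟩⟩
  | succ m ih =>
    intro p hp
    have hBm : (B ^ m) p ∈ P := by
      rw [Equiv.Perm.coe_pow]
      exact hB.iterate m hp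
    obtain ⟨r, ⟨hr0, hr1⟩, hAm⟩ := ih p hp
    obtain ⟨r', ⟨hr0', hr1'⟩, hA⟩ := h _ hBm
    refine ⟨r + r', ⟨by linarith, by push_cast; linarith⟩, ?_⟩
    have hmono : Set.Icc (p + η) (p + L - ((m + 1 : ℕ) + 1) * η) ⊆
        Set.Icc (p + η) (p + L - (m + 1) * η) := by
      refine Set.Icc_subset_Icc_right ?_
      push_cast
      linarith [hr0'.trans hr1']
    rw [pow_succ', pow_succ', Equiv.Perm.mul_apply,
      show (B ((B ^ m) p) : ℝ) - p + (r + r') =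
        ((B ^ m) p - p + r) + (B ((B ^ m) p) - (B ^ m) p + r') by ring]
    refine hA.mul (hAm.mono hmono) fun y hy => ?_
    obtain ⟨hy0, hy1⟩ := hy
    push_cast at hy1
    constructor <;> linarith

end Shadowing

section Circle

open Filter

theorem add_le_of_lt_of_mem_zmultiples {G : Type*} [AddCommGroup G] [LinearOrder G]
    [IsOrderedAddMonoid G] {p a b : G} (hp : 0 < p) (ha : a ∈ AddSubgroup.zmultiples p)
    (hb : b ∈ AddSubgroup.zmultiples p) (hab : a < b) : a + p ≤ b := by
  obtain ⟨m, hm : m • p = b - a⟩ := sub_mem hb ha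
  have hmpos : 0 < m := (zsmul_lt_zsmul_iff_left hp).1 (by rwa [zero_zsmul, hm, sub_pos])
  rw [← le_sub_iff_add_le', ← hm, ← one_zsmul p, smul_smul]
  simpa using zsmul_le_zsmul_left hp.le (show (1 : ℤ) ≤ m from hmpos)

variable {p : ℝ}

theorem norm_coe_le_abs_sub_of_mem_zmultiples {g : ℝ} (hg : g ∈ AddSubgroup.zmultiples p) (x : ℝ) :
    ‖(x : AddCircle p)‖ ≤ |x - g| := by
  have hg0 : (g : AddCircle p) = 0 := (QuotientAddGroup.eq_zero_iff g).2 hg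
  calc ‖(x : AddCircle p)‖ = ‖((x - g : ℝ) : AddCircle p)‖ := by
        rw [AddCircle.coe_sub, hg0, sub_zero]
    _ ≤ |x - g| := QuotientAddGroup.norm_mk_le_norm

theorem eventually_le_norm_add_coe (hp : 0 < p) (g : AddCircle p) (C : ℝ) :
    ∀ᶠ ρ in 𝓝[>] (0 : ℝ), ∀ r ∈ Set.Icc (3 * ρ) (C * ρ), 2 * ρ ≤ ‖g + (r : AddCircle p)‖ := by
  have small (K : ℝ) {ε : ℝ} (hε : 0 < ε) : ∀ᶠ ρ in 𝓝[>] (0 : ℝ), K * ρ < ε := by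
    have : Tendsto (fun ρ : ℝ => K * ρ) (𝓝 0) (𝓝 (K * 0)) :=
      (continuous_const_mul K).tendsto 0
    rw [mul_zero] at this
    exact (this.eventually_lt_const hε).filter_mono nhdsWithin_le_nhds
  rcases eq_or_ne g 0 with rfl | hg
  · filter_upwards [small C (half_pos hp), self_mem_nhdsWithin] with ρ hC hρ r hr
    have hρ : 0 < ρ := hρ
    have hr0 : 0 ≤ r := by linarith [hr.1]
    rw [zero_add, (AddCircle.norm_coe_eq_abs_iff p hp.ne').2
      (by rw [abs_of_nonneg hr0, abs_of_pos hp]; linarith [hr.2]), abs_of_nonneg hr0]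
    linarith [hr.1]
  · filter_upwards [small (2 + C) (norm_pos_iff.2 hg), self_mem_nhdsWithin] with ρ hC hρ r hr
    have hρ : 0 < ρ := hρ
    have hr : ‖(r : AddCircle p)‖ ≤ C * ρ := by
      refine QuotientAddGroup.norm_mk_le_norm.trans ?_
      rw [Real.norm_of_nonneg (by linarith [hr.1])]
      exact hr.2
    have : (2 + C) * ρ < ‖g‖ := hC
    linarith [norm_sub_le_norm_add g (r : AddCircle p)]

theorem exists_pos_forall_le_norm_add_sub (hp : 0 < p) {F : Set (AddCircle p)} (hF : F.Finite)
    (C : ℝ) :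
    ∃ ρ > 0, ∀ f ∈ F, ∀ f' ∈ F, ∀ r ∈ Set.Icc (3 * ρ) (C * ρ),
      2 * ρ ≤ ‖f + (r : AddCircle p) - f'‖ := by
  have hev : ∀ᶠ ρ in 𝓝[>] (0 : ℝ), ∀ f ∈ F, ∀ f' ∈ F, ∀ r ∈ Set.Icc (3 * ρ) (C * ρ),
      2 * ρ ≤ ‖f + (r : AddCircle p) - f'‖ := by
    refine (eventually_all_finite hF).2 fun f _ => (eventually_all_finite hF).2 fun f' _ => ?_
    simpa only [sub_add_eq_add_sub] using eventually_le_norm_add_coe hp (f - f') C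
  exact (eventually_mem_nhdsWithin.and hev).exists

end Circle

section Drift

variable {X : Set ℝ} {p a b ρ : ℝ} {A u g : Equiv.Perm X}

/-- Modulo `pℤ`, the permutation `A` moves every point to the right by an amount that lies between
`a` and `b`. -/
def DriftsBetween (p a b : ℝ) (A : Equiv.Perm X) : Prop :=
  ∀ x : X, ∃ r ∈ Set.Icc a b, ((A x : ℝ) : AddCircle p) = ((x + r : ℝ) : AddCircle p)

theorem DriftsBetween.pow (h : DriftsBetween p a b A) (k : ℕ) :
    DriftsBetween p (k * a) (k * b) (A ^ k) := by
  induction k with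
  | zero => exact fun x => ⟨0, by simp, by simp⟩
  | succ k ih =>
    intro x
    obtain ⟨r, hr, hx⟩ := ih x
    obtain ⟨r', hr', hx'⟩ := h ((A ^ k) x)
    refine ⟨r + r', ?_, ?_⟩
    · push_cast
      constructor <;> linarith [hr.1, hr.2, hr'.1, hr'.2]
    · rw [pow_succ', Equiv.Perm.mul_apply, hx', AddCircle.coe_add, hx, ← AddCircle.coe_add,
        add_assoc]

theorem commutatorElement_conj_eq_one_of_driftsBetween {F : Set (AddCircle p)}
    (hu : ∀ x, u x ≠ x → ∃ f ∈ F, ‖((x : ℝ) : AddCircle p) - f‖ < ρ)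
    (hg : DriftsBetween p a b g)
    (hF : ∀ f ∈ F, ∀ f' ∈ F, ∀ r ∈ Set.Icc a b, 2 * ρ ≤ ‖f + (r : AddCircle p) - f'‖) :
    ⁅u, g * u * g⁻¹⁆ = 1 := by
  refine commutatorElement_conj_eq_one_of_displaces_support fun x hx => ?_
  by_contra hgx
  obtain ⟨f, hf, hxf⟩ := hu x hx
  obtain ⟨f', hf', hgxf'⟩ := hu (g x) hgx
  obtain ⟨r, hr, hgr⟩ := hg x
  rw [hgr, AddCircle.coe_add] at hgxf'
  have : ‖f + (r : AddCircle p) - f'‖ < 2 * ρ := calc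
    ‖f + (r : AddCircle p) - f'‖ = ‖((x : ℝ) + r - f') - ((x : ℝ) - f)‖ := by congr 1; abel
    _ ≤ ‖((x : ℝ) : AddCircle p) + r - f'‖ + ‖((x : ℝ) : AddCircle p) - f‖ := norm_sub_le _ _
    _ < 2 * ρ := by linarith
  exact this.not_ge (hF f hf f' hf' r hr)

end Drift

section Lengths

variable {n : ℕ} (σ : Equiv.Perm (Fin n)) {l : Fin n → ℝ}

theorem leftEnd_mem {G : AddSubgroup ℝ} (hl : ∀ i, l i ∈ G) (i : Fin n) : leftEnd σ l i ∈ G :=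
  sum_mem fun j _ => hl j

theorem translationLength_mem {G : AddSubgroup ℝ} (hl : ∀ i, l i ∈ G) (i : Fin n) :
    translationLength σ l i ∈ G :=
  sub_mem (leftEnd_mem σ hl i) (leftEnd_mem 1 hl i)

variable (l)

theorem leftEnd_sub (l' : Fin n → ℝ) (i : Fin n) :
    leftEnd σ (l - l') i = leftEnd σ l i - leftEnd σ l' i := by
  simp only [leftEnd, Pi.sub_apply, Finset.sum_sub_distrib]

theorem translationLength_sub (l' : Fin n → ℝ) (i : Fin n) :
    translationLength σ (l - l') i = translationLength σ l i - translationLength σ l' i := by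
  simp only [translationLength, leftEnd_sub]
  ring

theorem translationLength_smul (s : ℝ) (i : Fin n) :
    translationLength σ (s • l) i = s * translationLength σ l i := by
  simp only [translationLength, leftEnd, Pi.smul_apply, smul_eq_mul, ← Finset.mul_sum, mul_sub]

theorem continuous_translationLength (i : Fin n) :
    Continuous fun l : Fin n → ℝ => translationLength σ l i := by
  unfold translationLength leftEnd
  fun_prop

theorem leftEnd_add_self (i : Fin n) : leftEnd σ l i + l i = ∑ j with σ j ≤ σ i, l j := by
  rw [leftEnd, add_comm, ← Finset.sum_insert (by simp)]
  congr 1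
  ext j
  simp [le_iff_eq_or_lt]

theorem leftEnd_add_eq_leftEnd_or_sum (i : Fin n) :
    (∃ j, leftEnd σ l i + l i = leftEnd σ l j) ∨ leftEnd σ l i + l i = ∑ j, l j := by
  rw [leftEnd_add_self]
  by_cases hi : (σ i : ℕ) + 1 < n
  · refine Or.inl ⟨σ.symm ⟨σ i + 1, hi⟩, Finset.sum_congr (Finset.filter_congr fun j _ => ?_)
      fun _ _ => rfl⟩
    rw [Equiv.apply_symm_apply, Fin.le_def, Fin.lt_def]
    exact Nat.lt_succ_iff.symm
  · refine Or.inr (Finset.sum_congr (Finset.filter_true_of_mem fun j _ => ?_) fun _ _ => rfl)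
    have := (σ j).isLt
    rw [Fin.le_def]
    omega

theorem abs_leftEnd_le (i : Fin n) : |leftEnd σ l i| ≤ ∑ j, |l j| :=
  (Finset.abs_sum_le_sum_abs _ _).trans
    (Finset.sum_le_univ_sum_of_nonneg fun _ => abs_nonneg _)

theorem abs_leftEnd_add_le (i : Fin n) : |leftEnd σ l i + l i| ≤ ∑ j, |l j| := by
  rw [leftEnd_add_self]
  exact (Finset.abs_sum_le_sum_abs _ _).trans
    (Finset.sum_le_univ_sum_of_nonneg fun _ => abs_nonneg _)

theorem abs_translationLength_le (i : Fin n) : |translationLength σ l i| ≤ 2 * ∑ j, |l j| := by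
  rw [two_mul]
  exact (abs_sub _ _).trans (add_le_add (abs_leftEnd_le σ l i) (abs_leftEnd_le 1 l i))

end Lengths

namespace IET

variable (T : IET)

theorem exists_mem_Ico (x : Set.Ico (0 : ℝ) 1) :
    ∃ i, (x : ℝ) ∈ Set.Ico (leftEnd 1 T.len i) (leftEnd 1 T.len i + T.len i) := by
  obtain ⟨⟨i, s, hs0, hs1⟩, rfl⟩ := (tileFun_bijective 1 T.len T.len_pos T.len_sum).surjective x
  exact ⟨i, le_add_of_nonneg_right hs0, add_lt_add_of_le_of_lt le_rfl hs1⟩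

theorem nonempty_fin : Nonempty (Fin T.n) :=
  ⟨(T.exists_mem_Ico ⟨0, le_rfl, one_pos⟩).choose⟩

theorem translatesOn_Ico (i : Fin T.n) :
    TranslatesOn T.toPerm (Set.Ico (leftEnd 1 T.len i) (leftEnd 1 T.len i + T.len i))
      (translationLength T.perm T.len i) := fun _ hy =>
  ⟨⟨(leftEnd_nonneg 1 T.len T.len_pos i).trans hy.1,
    hy.2.trans_le (leftEnd_add_le_one 1 T.len T.len_pos T.len_sum i)⟩,
    T.toPerm_apply i _ hy.1 hy.2⟩

/-- The IET with the same permutation as `T` and with lengths `l`. -/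
abbrev withLen (l : Fin T.n → ℝ) (hpos : ∀ i, 0 < l i) (hsum : ∑ i, l i = 1) : IET :=
  ⟨T.n, T.perm, l, hpos, hsum, T.reduced⟩

variable {T}

theorem edist_withLen (l : Fin T.n → ℝ) (hpos : ∀ i, 0 < l i) (hsum : ∑ i, l i = 1) :
    edist (T.withLen l hpos hsum) T = ENNReal.ofReal (∑ i, |l i - T.len i|) :=
  edist_mk ..

theorem sum_abs_lt_of_edist_withLen_lt {ε : ℝ} {l : Fin T.n → ℝ}
    {hpos : ∀ i, 0 < l i} {hsum : ∑ i, l i = 1}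
    (h : edist (T.withLen l hpos hsum) T < ENNReal.ofReal ε) :
    ∑ i, |(l - T.len) i| < ε := by
  rw [edist_withLen] at h
  exact (ENNReal.ofReal_lt_ofReal_iff'.1 h).1

theorem withLen_eq_self_iff (l : Fin T.n → ℝ) (hpos : ∀ i, 0 < l i) (hsum : ∑ i, l i = 1) :
    T.withLen l hpos hsum = T ↔ l = T.len := by
  obtain ⟨n, σ, l', hpos', hsum', hred'⟩ := T
  simp

theorem exists_eq_withLen_of_edist_lt {T' : IET} {ε : ℝ} (h : edist T' T < ENNReal.ofReal ε) :
    ∃ l hpos hsum, T' = T.withLen l hpos hsum ∧ ∑ i, |(l - T.len) i| < ε := by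
  have htype : T'.type = T.type := by
    by_contra hne
    simp [edist_of_type_ne hne] at h
  obtain ⟨n, σ, l, hpos, hsum, hred⟩ := T'
  obtain ⟨n', σ', l', hpos', hsum', hred'⟩ := T
  cases htype
  rw [edist_mk] at h
  exact ⟨l, hpos, hsum, rfl, (ENNReal.ofReal_lt_ofReal_iff'.1 h).1⟩

end IET

section Grid

variable {q : ℕ} {T : IET}

theorem one_mem_zmultiples_inv (hq : 0 < q) : (1 : ℝ) ∈ AddSubgroup.zmultiples (q⁻¹ : ℝ) :=
  ⟨q, by simp [hq.ne']⟩

theorem IET.IsQRational.leftEnd_one_mem_zmultiples (h : T.IsQRational q) (i : Fin T.n) :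
    leftEnd 1 T.len i ∈ AddSubgroup.zmultiples (q⁻¹ : ℝ) := by
  rcases Nat.eq_zero_or_pos i with hi | hi
  · have hzero : leftEnd 1 T.len i = 0 := Finset.sum_eq_zero fun j hj => by
      simp [Fin.lt_def, hi] at hj
    exact hzero ▸ zero_mem _
  · obtain ⟨m, hm⟩ := h _ ⟨i, hi, rfl⟩
    exact ⟨m, by simp [hm, div_eq_mul_inv]⟩

theorem IET.IsQRational.len_mem_zmultiples (hq : 0 < q) (h : T.IsQRational q) (i : Fin T.n) :
    T.len i ∈ AddSubgroup.zmultiples (q⁻¹ : ℝ) := by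
  rw [← AddSubgroup.add_mem_cancel_left _ (h.leftEnd_one_mem_zmultiples i)]
  rcases leftEnd_add_eq_leftEnd_or_sum 1 T.len i with ⟨j, hj⟩ | hsum
  · exact hj ▸ h.leftEnd_one_mem_zmultiples j
  · rw [hsum, T.len_sum]
    exact one_mem_zmultiples_inv hq

/-- The points of `[0, 1)` that are multiples of `1 / q`. -/
def gridPoints (q : ℕ) : Set (Set.Ico (0 : ℝ) 1) :=
  {x | (x : ℝ) ∈ AddSubgroup.zmultiples (q⁻¹ : ℝ)}

theorem ncard_gridPoints (hq : 0 < q) : (gridPoints q).ncard = q := by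
  have hq' : (0 : ℝ) < q := Nat.cast_pos.2 hq
  let e (i : Fin q) : Set.Ico (0 : ℝ) 1 :=
    ⟨i / q, by positivity, (div_lt_one hq').2 (Nat.cast_lt.2 i.2)⟩
  have he : Function.Injective e := fun i j hij => by
    have : (i : ℝ) / q = j / q := congrArg Subtype.val hij
    rwa [div_left_inj' hq'.ne', Nat.cast_inj, ← Fin.ext_iff] at this
  have hrange : gridPoints q = Set.range e := by
    ext x
    constructor
    · rintro ⟨m, hm⟩
      have hm : (m : ℝ) = x * q := by simp [← hm, hq'.ne']
      have hm0 : 0 ≤ m := by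
        rw [← Int.cast_nonneg_iff (R := ℝ), hm]
        exact mul_nonneg x.2.1 hq'.le
      lift m to ℕ using hm0
      have hmq : m < q := by
        rw [← Nat.cast_lt (α := ℝ), ← Int.cast_natCast, hm]
        exact mul_lt_of_lt_one_left hq' x.2.2
      exact ⟨⟨m, hmq⟩, Subtype.ext ((div_eq_iff hq'.ne').2 hm)⟩
    · rintro ⟨i, rfl⟩
      exact ⟨i, by simp [e, div_eq_mul_inv]⟩
  rw [hrange, ← Nat.card_coe_set_eq, Nat.card_range_of_injective he, Nat.card_fin]

theorem exists_gridPoint_mem_Icc (hq : 0 < q) {x : Set.Ico (0 : ℝ) 1} {ρ : ℝ}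
    (hx : ρ ≤ ‖((x : ℝ) : AddCircle (q⁻¹ : ℝ))‖) :
    ∃ p ∈ gridPoints q, (x : ℝ) ∈ Set.Icc (p + ρ) (p + (q : ℝ)⁻¹ - ρ) := by
  have hq' : (0 : ℝ) < q := Nat.cast_pos.2 hq
  have far (m : ℤ) : ρ ≤ |(x : ℝ) - m / q| :=
    hx.trans (norm_coe_le_abs_sub_of_mem_zmultiples ⟨m, by simp [div_eq_mul_inv]⟩ _)
  let m : ℤ := ⌊(x : ℝ) * q⌋
  have hmx : (m : ℝ) / q ≤ x := (div_le_iff₀ hq').2 (Int.floor_le _)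
  have hxm : (x : ℝ) < (m + 1 : ℤ) / q := by
    rw [lt_div_iff₀ hq', Int.cast_add, Int.cast_one]
    exact Int.lt_floor_add_one _
  have hm0 : (0 : ℝ) ≤ m / q :=
    div_nonneg (Int.cast_nonneg (Int.floor_nonneg.2 (mul_nonneg x.2.1 hq'.le))) hq'.le
  refine ⟨⟨m / q, hm0, hmx.trans_lt x.2.2⟩, ⟨m, by simp [div_eq_mul_inv]⟩, ?_, ?_⟩
  · have := far m
    rw [abs_of_nonneg (sub_nonneg.2 hmx)] at this
    linarith
  · have := far (m + 1)
    rw [abs_of_neg (sub_neg.2 hxm)] at this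
    push_cast [add_div, one_div] at this
    linarith

theorem IET.IsQRational.mapsTo_gridPoints (hq : 0 < q) (h : T.IsQRational q) :
    Set.MapsTo T.toPerm (gridPoints q) (gridPoints q) := by
  intro x hx
  obtain ⟨i, hi⟩ := T.exists_mem_Ico x
  simp only [gridPoints, Set.mem_ofPred_eq, (T.translatesOn_Ico i).apply_eq hi]
  exact add_mem hx (translationLength_mem _ (h.len_mem_zmultiples hq) i)

theorem IET.IsQRational.pow_factorial_apply_gridPoint (hq : 0 < q) (h : T.IsQRational q)
    {p : Set.Ico (0 : ℝ) 1} (hp : p ∈ gridPoints q) : (T.toPerm ^ q.factorial) p = p := by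
  have hcard := ncard_gridPoints hq
  have := perm_pow_factorial_ncard_apply_eq_self T.toPerm
    (Set.finite_of_ncard_ne_zero (hcard.trans_ne hq.ne')) (h.mapsTo_gridPoints hq) hp
  rwa [hcard] at this

end Grid

section Marks

variable {p c : ℝ} {A : Equiv.Perm (Set.Ico (0 : ℝ) 1)}

/-- Immediately to the left of every point whose distance to `pℤ` is at least `3 * c`, the
permutation `A` is a translation to the right by at most `c`. -/
def LocallyTranslates (p c : ℝ) (A : Equiv.Perm (Set.Ico (0 : ℝ) 1)) : Prop :=
  ∀ x : Set.Ico (0 : ℝ) 1, 3 * c ≤ ‖((x : ℝ) : AddCircle p)‖ →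
    ∃ a ∈ Set.Icc 0 c, TranslatesOn A (Set.Icc (x - 2 * c) x) a

/-- The points near which, modulo `p`, the commutator `⁅A, R * A * R⁻¹⁆` may move something when `A`
is as in `LocallyTranslates`: far from them, `x` and `R⁻¹ x` are far from `pℤ`, and `R⁻¹ x` is far
from the ends of the interval of `R` that contains it. -/
def IET.marks (R : IET) : Set ℝ :=
  {0} ∪ Set.range (leftEnd R.perm R.len) ∪ Set.range (translationLength R.perm R.len)

theorem IET.finite_marks (R : IET) : R.marks.Finite :=
  ((Set.finite_singleton 0).union (Set.finite_range _)).union (Set.finite_range _)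

theorem IET.exists_mem_marks_abs_sub_lt {R S : IET} {ε : ℝ}
    (h : edist R S < ENNReal.ofReal ε) {y : ℝ} (hy : y ∈ R.marks) :
    ∃ z ∈ S.marks, |y - z| < 2 * ε := by
  obtain ⟨l, hpos, hsum, rfl, hl⟩ := exists_eq_withLen_of_edist_lt h
  have hl0 : 0 ≤ ∑ i, |(l - S.len) i| := Finset.sum_nonneg fun _ _ => abs_nonneg _
  rcases hy with (rfl | ⟨i, rfl⟩) | ⟨i, rfl⟩
  · exact ⟨0, Or.inl (Or.inl rfl), by rw [sub_zero, abs_zero]; linarith⟩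
  · refine ⟨_, Or.inl (Or.inr ⟨i, rfl⟩), ?_⟩
    change |leftEnd S.perm l i - leftEnd S.perm S.len i| < _
    rw [← leftEnd_sub]
    linarith [abs_leftEnd_le S.perm (l - S.len) i]
  · refine ⟨_, Or.inr ⟨i, rfl⟩, ?_⟩
    change |translationLength S.perm l i - translationLength S.perm S.len i| < _
    rw [← translationLength_sub]
    linarith [abs_translationLength_le S.perm (l - S.len) i]

theorem LocallyTranslates.commutatorElement_conj_apply_eq_self (hc : 0 < c)
    (hp : 1 ∈ AddSubgroup.zmultiples p) (hA : LocallyTranslates p c A) (R : IET)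
    {x : Set.Ico (0 : ℝ) 1} (hx : ∀ y ∈ R.marks, 3 * c ≤ ‖((x - y : ℝ) : AddCircle p)‖) :
    ⁅A, R.toPerm * A * R.toPerm⁻¹⁆ x = x := by
  obtain ⟨a, ⟨ha0, ha1⟩, hAa⟩ := hA x (by simpa using hx 0 (Or.inl (Or.inl rfl)))
  obtain ⟨y, rfl⟩ := R.toPerm.surjective x
  obtain ⟨i, hi0, hi1⟩ := R.exists_mem_Ico y
  set τ := translationLength R.perm R.len i with hτ
  have hR := R.translatesOn_Ico i
  have hRy : (R.toPerm y : ℝ) = y + τ := hR.apply_eq ⟨hi0, hi1⟩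
  have hleft : leftEnd R.perm R.len i = leftEnd 1 R.len i + τ := by
    rw [hτ, translationLength]
    ring
  obtain ⟨b, ⟨hb0, hb1⟩, hAb⟩ := hA y (by simpa [hRy] using hx τ (Or.inr ⟨i, rfl⟩))
  have far_left : leftEnd 1 R.len i + 3 * c ≤ y := by
    have := (hx _ (Or.inl (Or.inr ⟨i, rfl⟩))).trans QuotientAddGroup.norm_mk_le_norm
    rw [Real.norm_eq_abs, hRy, hleft, abs_of_nonneg (by linarith)] at this
    linarith
  have far_right : y + 3 * c ≤ leftEnd 1 R.len i + R.len i := by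
    suffices 3 * c ≤ |(R.toPerm y : ℝ) - (leftEnd R.perm R.len i + R.len i)| by
      rw [hRy, hleft, abs_of_neg (by linarith)] at this
      linarith
    rcases leftEnd_add_eq_leftEnd_or_sum R.perm R.len i with ⟨j, hj⟩ | hsum
    · rw [hj]
      exact (hx _ (Or.inl (Or.inr ⟨j, rfl⟩))).trans QuotientAddGroup.norm_mk_le_norm
    · rw [hsum, R.len_sum]
      refine le_trans ?_ (norm_coe_le_abs_sub_of_mem_zmultiples hp _)
      simpa using hx 0 (Or.inl (Or.inl rfl))
  have hconj : TranslatesOn (R.toPerm * A * R.toPerm⁻¹)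
      ((· - τ) ⁻¹' Set.Icc (y - 2 * c) y) b :=
    hR.conj hAb (fun z hz => ⟨by linarith [hz.1], hz.2.trans_lt hi1⟩)
      fun z hz => ⟨by linarith [hz.1], by linarith [hz.2]⟩
  rw [Set.preimage_sub_const_Icc, ← hRy, sub_add_eq_add_sub, ← hRy] at hconj
  have hcomm := hAa.commutatorElement hconj (x := (R.toPerm y : ℝ))
    ⟨by linarith, by linarith⟩ ⟨by linarith, by linarith⟩ ⟨by linarith, by linarith⟩
  exact Subtype.ext ((hcomm.apply_eq rfl).trans (add_zero _))

end Marks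

section Cone

variable {n : ℕ} {σ : Equiv.Perm (Fin n)} {K : ℝ} {d : Fin n → ℝ}

/-- The changes of lengths that increase all translation lengths, by amounts whose ratios are
less than `K`. -/
def driftCone (σ : Equiv.Perm (Fin n)) (K : ℝ) : Set (Fin n → ℝ) :=
  {d | ∃ δ > 0, ∀ i, translationLength σ d i ∈ Set.Ioo δ (K * δ)}

theorem isOpen_driftCone : IsOpen (driftCone σ K) := by
  have : driftCone σ K =
      ⋃ δ > 0, ⋂ i, (translationLength σ · i) ⁻¹' Set.Ioo δ (K * δ) := by
    ext d
    simp [driftCone]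
  rw [this]
  exact isOpen_biUnion fun δ _ => isOpen_iInter_of_finite fun i =>
    isOpen_Ioo.preimage (continuous_translationLength σ i)

theorem smul_mem_driftCone (hd : d ∈ driftCone σ K) {s : ℝ} (hs : 0 < s) :
    s • d ∈ driftCone σ K := by
  obtain ⟨δ, hδ, h⟩ := hd
  refine ⟨s * δ, mul_pos hs hδ, fun i => ?_⟩
  rw [translationLength_smul, mul_left_comm]
  exact ⟨mul_lt_mul_of_pos_left (h i).1 hs, mul_lt_mul_of_pos_left (h i).2 hs⟩

theorem zero_notMem_driftCone [Nonempty (Fin n)] : 0 ∉ driftCone σ K := by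
  rintro ⟨δ, hδ, h⟩
  obtain ⟨i⟩ := ‹Nonempty (Fin n)›
  have hzero : translationLength σ 0 i = 0 := by simp [translationLength, leftEnd]
  exact (hzero ▸ (h i).1).not_gt hδ

theorem Driftable.exists_mem_driftCone (hσ : Driftable σ) :
    ∃ K > 0, ∃ d ∈ driftCone σ K, ∑ i, d i = 0 := by
  obtain ⟨l, d, -, -, hsum, -, hlt⟩ := hσ
  have hpos (i) : 0 < translationLength σ d i := by
    have hd : d = (fun j => l j + d j) - l := by
      ext j
      simp
    rw [hd, translationLength_sub, sub_pos]
    exact hlt i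
  obtain ⟨δ, hδ, hδlt⟩ := Pi.exists_forall_pos_add_lt hpos
  simp only [zero_add] at hδlt
  obtain ⟨M, hM⟩ := Finite.bddAbove_range (translationLength σ d)
  refine ⟨(|M| + 1) / δ, by positivity, d, ⟨δ, hδ, fun i => ⟨hδlt i, ?_⟩⟩, hsum⟩
  rw [div_mul_cancel₀ _ hδ.ne']
  linarith [hM ⟨i, rfl⟩, le_abs_self M]

end Cone

namespace IET

variable {T T₀ : IET} {K η : ℝ} {q : ℕ}

/-- The IETs with the same permutation as `T₀` whose lengths differ from those of `T₀` by an
element of `driftCone T₀.perm K`. -/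
def drifted (T₀ : IET) (K : ℝ) : Set IET :=
  {T | ∃ l hpos hsum, T = T₀.withLen l hpos hsum ∧ l - T₀.len ∈ driftCone T₀.perm K}

theorem type_eq_of_mem_drifted (hT : T ∈ T₀.drifted K) : T.type = T₀.type := by
  obtain ⟨l, hpos, hsum, rfl, -⟩ := hT
  rfl

theorem isOpen_drifted : IsOpen (T₀.drifted K) := by
  rw [EMetric.isOpen_iff]
  rintro _ ⟨l, hpos, hsum, rfl, hl⟩
  obtain ⟨ε, hε, hball⟩ := Metric.isOpen_iff.1
    (isOpen_driftCone.preimage (continuous_id.sub continuous_const)) l hl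
  refine ⟨ENNReal.ofReal ε, ENNReal.ofReal_pos.2 hε, fun T hT => ?_⟩
  obtain ⟨l', hpos', hsum', rfl, hl'⟩ := exists_eq_withLen_of_edist_lt hT
  refine ⟨l', hpos', hsum', rfl, hball ((dist_pi_lt_iff hε).2 fun i => lt_of_le_of_lt ?_ hl')⟩
  exact Finset.single_le_sum (f := fun i => |(l' - l) i|) (fun j _ => abs_nonneg ((l' - l) j))
    (Finset.mem_univ i)

theorem accPt_drifted {d : Fin T₀.n → ℝ} (hd : d ∈ driftCone T₀.perm K) (hsum : ∑ i, d i = 0) :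
    AccPt T₀ (Filter.principal (T₀.drifted K)) := by
  have hcont : Continuous fun s : ℝ => T₀.len + s • d := by fun_prop
  have hpos : ∀ᶠ s in 𝓝[>] (0 : ℝ), ∀ i, 0 < (T₀.len + s • d) i := by
    refine Filter.eventually_all.2 fun i => nhdsWithin_le_nhds ?_
    refine ((continuous_apply i).comp hcont).continuousAt.eventually_const_lt ?_
    simpa using T₀.len_pos i
  have hdist : Continuous fun s : ℝ => ENNReal.ofReal (∑ i, |(T₀.len + s • d) i - T₀.len i|) :=
    ENNReal.continuous_ofReal.comp (by fun_prop)
  rw [accPt_iff_frequently, Metric.nhds_basis_eball.frequently_iff]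
  intro ε hε
  obtain ⟨s, hs, hspos, hsε⟩ := (eventually_mem_nhdsWithin.and (hpos.and (nhdsWithin_le_nhds
    (hdist.continuousAt.eventually_lt_const (by simpa using hε))))).exists
  have hssum : ∑ i, (T₀.len + s • d) i = 1 := by
    simp [Finset.sum_add_distrib, ← Finset.mul_sum, hsum, T₀.len_sum]
  have hsd : s • d ∈ driftCone T₀.perm K := smul_mem_driftCone hd hs
  refine ⟨T₀.withLen _ hspos hssum, (edist_withLen _ hspos hssum).trans_lt hsε, fun heq => ?_,
    _, hspos, hssum, rfl, by rwa [add_sub_cancel_left]⟩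
  rw [withLen_eq_self_iff, add_eq_left] at heq
  have := T₀.nonempty_fin
  exact zero_notMem_driftCone (heq ▸ hsd)

theorem IsQRational.exists_driftsBetween (hq : 0 < q) (hT₀ : T₀.IsQRational q)
    (hT : T ∈ T₀.drifted K) (hη : edist T T₀ < ENNReal.ofReal (η / 2)) :
    ∃ δ ∈ Set.Ioc 0 η, DriftsBetween (q⁻¹ : ℝ) δ (K * δ) T.toPerm := by
  obtain ⟨l, hpos, hsum, rfl, δ, hδ, hl⟩ := hT
  have hlη := sum_abs_lt_of_edist_withLen_lt hη
  obtain ⟨i₀⟩ := T₀.nonempty_fin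
  refine ⟨δ, ⟨hδ, ?_⟩, fun x => ?_⟩
  · linarith [(hl i₀).1, le_abs_self (translationLength T₀.perm (l - T₀.len) i₀),
      abs_translationLength_le T₀.perm (l - T₀.len) i₀]
  · obtain ⟨i, hi⟩ := (T₀.withLen l hpos hsum).exists_mem_Ico x
    refine ⟨_, Set.Ioo_subset_Icc_self (hl i), ?_⟩
    rw [((T₀.withLen l hpos hsum).translatesOn_Ico i).apply_eq hi, ← sub_eq_zero,
      ← AddCircle.coe_sub, translationLength_sub, add_sub_add_left_eq_sub, sub_sub_cancel]
    exact (QuotientAddGroup.eq_zero_iff _).2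
      (translationLength_mem _ (hT₀.len_mem_zmultiples hq) i)

theorem IsQRational.exists_translatesOn_gridCell (hq : 0 < q) (hT₀ : T₀.IsQRational q)
    (hT : T ∈ T₀.drifted K) (hη : edist T T₀ < ENNReal.ofReal (η / 2))
    {p : Set.Ico (0 : ℝ) 1} (hp : p ∈ gridPoints q) :
    ∃ r ∈ Set.Icc 0 η,
      TranslatesOn T.toPerm (Set.Icc (p + η) (p + (q : ℝ)⁻¹ - η)) (T₀.toPerm p - p + r) := by
  obtain ⟨l, hpos, hsum, rfl, δ, hδ, hl⟩ := hT
  have hlη := sum_abs_lt_of_edist_withLen_lt hη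
  obtain ⟨i, hpi⟩ := T₀.exists_mem_Ico p
  have hright : p + (q : ℝ)⁻¹ ≤ leftEnd 1 T₀.len i + T₀.len i :=
    add_le_of_lt_of_mem_zmultiples (by positivity) hp
      (add_mem (hT₀.leftEnd_one_mem_zmultiples i) (hT₀.len_mem_zmultiples hq i)) hpi.2
  have hd₁ := abs_leftEnd_le 1 (l - T₀.len) i
  have hd₂ := abs_leftEnd_add_le 1 (l - T₀.len) i
  have hd₃ := abs_translationLength_le T₀.perm (l - T₀.len) i
  rw [leftEnd_sub, abs_le] at hd₁
  rw [leftEnd_sub, Pi.sub_apply, abs_le] at hd₂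
  rw [abs_le] at hd₃
  refine ⟨translationLength T₀.perm (l - T₀.len) i,
    ⟨(hδ.trans (hl i).1).le, by linarith [hd₃.2]⟩, ?_⟩
  rw [(T₀.translatesOn_Ico i).apply_eq hpi, add_sub_cancel_left, translationLength_sub,
    add_sub_cancel]
  exact ((T₀.withLen l hpos hsum).translatesOn_Ico i).mono fun y hy =>
    ⟨by linarith [hy.1, hd₁.1, hd₁.2, hpi.1], by linarith [hy.2, hd₂.1, hd₂.2]⟩

theorem IsQRational.locallyTranslates_pow_factorial (hq : 0 < q) (hT₀ : T₀.IsQRational q)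
    (hT : T ∈ T₀.drifted K) (hη : edist T T₀ < ENNReal.ofReal (η / 2)) :
    LocallyTranslates (q⁻¹ : ℝ) ((q.factorial + 1) * η) (T.toPerm ^ q.factorial) := by
  intro x hx
  obtain ⟨p, hp, hpx⟩ := exists_gridPoint_mem_Icc hq hx
  obtain ⟨r, ⟨hr0, hr⟩, hTr⟩ := translatesOn_pow_of_shadowing (hT₀.mapsTo_gridPoints hq)
    (fun p hp => hT₀.exists_translatesOn_gridCell hq hT hη hp) q.factorial p hp
  rw [hT₀.pow_factorial_apply_gridPoint hq hp, sub_self, zero_add] at hTr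
  have hη0 : 0 ≤ η :=
    let ⟨_, hs, _⟩ := hT₀.exists_translatesOn_gridCell hq hT hη hp
    hs.1.trans hs.2
  have : 0 ≤ q.factorial * η := by positivity
  exact ⟨r, ⟨hr0, by linarith⟩, hTr.mono
    (Set.Icc_subset_Icc (by linarith [hpx.1]) (by linarith [hpx.2]))⟩

end IET

theorem driftWord_toPerm_eq_one {q k : ℕ} (hq : 0 < q) {c a b : ℝ} (hc : 0 < c) {R S : IET}
    (hRS : edist R S < ENNReal.ofReal (c / 2)) {t : Equiv.Perm (Set.Ico (0 : ℝ) 1)}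
    (ht : LocallyTranslates (q⁻¹ : ℝ) c (t ^ q.factorial))
    (htk : DriftsBetween (q⁻¹ : ℝ) a b (t ^ k))
    (hS : ∀ f ∈ ((↑) '' S.marks : Set (AddCircle (q⁻¹ : ℝ))), ∀ f' ∈ (↑) '' S.marks,
      ∀ r ∈ Set.Icc a b, 2 * (4 * c) ≤ ‖f + (r : AddCircle (q⁻¹ : ℝ)) - f'‖) :
    driftWord q k R.toPerm t = 1 := by
  refine commutatorElement_conj_eq_one_of_driftsBetween (fun x hx => ?_) htk hS
  by_contra! hfar
  refine hx (ht.commutatorElement_conj_apply_eq_self hc (one_mem_zmultiples_inv hq) R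
    fun y hy => ?_)
  obtain ⟨z, hz, hyz⟩ := IET.exists_mem_marks_abs_sub_lt hRS hy
  have hxz := hfar z ⟨z, hz, rfl⟩
  have hyz' : ‖y - z‖ < c := hyz.trans_eq (mul_div_cancel₀ c two_ne_zero)
  have := norm_add_le ((x - y : ℝ) : AddCircle (q⁻¹ : ℝ)) ((y - z : ℝ) : AddCircle (q⁻¹ : ℝ))
  rw [← AddCircle.coe_add, sub_add_sub_cancel, AddCircle.coe_sub] at this
  linarith [QuotientAddGroup.norm_mk_le_norm (S := AddSubgroup.zmultiples (q⁻¹ : ℝ)) (m := y - z)]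

theorem exists_pos_nat_mul_mem_Icc {R : Type*} [Field R] [LinearOrder R]
    [IsStrictOrderedRing R] [FloorSemiring R] {a δ : R} (ha : 0 < a) (hδ : 0 < δ) :
    ∃ k : ℕ, 0 < k ∧ k * δ ∈ Set.Icc a (a + δ) := by
  refine ⟨⌈a / δ⌉₊, Nat.ceil_pos.2 (div_pos ha hδ), ?_, ?_⟩
  · exact (div_le_iff₀ hδ).1 (Nat.le_ceil _)
  · have := mul_le_mul_of_nonneg_right (Nat.ceil_lt_add_one (div_pos ha hδ).le).le hδ.le
    rwa [add_mul, div_mul_cancel₀ _ hδ.ne', one_mul] at this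

theorem mainTheorem2_general (q : ℕ) (hq : 0 < q) (T₀ : IET) (hT₀ : T₀.IsQRational q)
    (hσ : Driftable T₀.perm) (S : IET) :
    ∃ U ∈ 𝓝 S, ∃ V : Set IET,
      IsOpen V ∧ (∀ T ∈ V, T.type = T₀.type) ∧ AccPt T₀ (Filter.principal V) ∧
      ∀ R ∈ U, ∀ T ∈ V,
        ¬ Nonempty (Subgroup.closure {R.toPerm, T.toPerm} ≃* FreeGroup (Fin 2)) ∧
        ∃ k : ℕ, 0 < k ∧
          driftWord q k (FreeGroup.of (0 : Fin 2)) (FreeGroup.of (1 : Fin 2)) ≠ 1 ∧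
          driftWord q k R.toPerm T.toPerm = 1 := by
  have hp : (0 : ℝ) < (q : ℝ)⁻¹ := by positivity
  obtain ⟨K, hK, d, hd, hdsum⟩ := hσ.exists_mem_driftCone
  obtain ⟨ρ, hρ, hS⟩ := exists_pos_forall_le_norm_add_sub hp (S.finite_marks.image (↑)) (4 * K)
  let η := ρ / 4 / (q.factorial + 1)
  have hη : 0 < η := by positivity
  have hηρ : (q.factorial + 1) * η = ρ / 4 := mul_div_cancel₀ _ (by positivity)
  have hηρ' : η ≤ ρ := by linarith [show 0 ≤ q.factorial * η by positivity]
  refine ⟨Metric.eball S (.ofReal (ρ / 4 / 2)), Metric.eball_mem_nhds _ (by simpa),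
    Metric.eball T₀ (.ofReal (η / 2)) ∩ T₀.drifted K,
    Metric.isOpen_eball.inter IET.isOpen_drifted, fun T hT => IET.type_eq_of_mem_drifted hT.2,
    (IET.accPt_drifted hd hdsum).nhds_inter (Metric.eball_mem_nhds _ (by simpa)), ?_⟩
  rintro R hR T ⟨hTη, hT⟩
  obtain ⟨δ, ⟨hδ, hδη⟩, hdrifts⟩ := hT₀.exists_driftsBetween hq hT hTη
  obtain ⟨k, hk, hkδ⟩ := exists_pos_nat_mul_mem_Icc (mul_pos three_pos hρ) hδ
  have hword : driftWord q k R.toPerm T.toPerm = 1 := by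
    refine driftWord_toPerm_eq_one hq (by positivity) hR
      (hηρ ▸ hT₀.locallyTranslates_pow_factorial hq hT hTη) (hdrifts.pow k)
      fun f hf f' hf' r hr => ?_
    rw [mul_div_cancel₀ _ four_ne_zero]
    refine hS f hf f' hf' r ⟨hkδ.1.trans hr.1, hr.2.trans ?_⟩
    calc k * (K * δ) = K * (k * δ) := mul_left_comm _ _ _
      _ ≤ K * (3 * ρ + ρ) := mul_le_mul_of_nonneg_left (by linarith [hkδ.2]) hK.le
      _ = 4 * K * ρ := by ring
  exact ⟨not_nonempty_iff.2 (isEmpty_closure_pair_mulEquiv_freeGroup hk hword), k, hk,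
    driftWord_freeGroup_ne_one q hk, hword⟩

theorem mainTheorem2 (q : ℕ) (hq : 0 < q) (T₀ : IET) (hT₀ : T₀.IsQRational q)
    (hdrift : Driftable T₀.perm) (S : IET) :
    ∃ U V : Set IET,
      S ∈ U ∧
      IsOpen V ∧ (∀ T ∈ V, T.type = T₀.type) ∧ AccPt T₀ (Filter.principal V) ∧
      (∀ R ∈ U, ∀ T ∈ V,
        ¬ Nonempty (Subgroup.closure {R.toPerm, T.toPerm} ≃* FreeGroup (Fin 2)) ∧
        ∃ k : ℕ, 0 < k ∧
          driftWord q k (FreeGroup.of (0 : Fin 2)) (FreeGroup.of (1 : Fin 2)) ≠ 1 ∧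
          driftWord q k R.toPerm T.toPerm = 1) ∧
      ((S.IsRational ∨
          ∀ x ∈ S.disc, ∀ y ∈ S.disc, x ≠ y → ¬ ∃ m : ℤ, x - y = m / q) →
        U ∈ 𝓝 S) := by
  obtain ⟨U, hU, V, hV, htype, hacc, h⟩ := mainTheorem2_general q hq T₀ hT₀ hdrift S
  exact ⟨U, V, mem_of_mem_nhds hU, hV, htype, hacc, h, fun _ => hU⟩
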